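/- For a subshift $X\subset S^{\mathbb Z}$ over a finite alphabet $S$, let $\mathcal B(X)\subset S^*$ be the set of finite words that occur in points of $X$. Call $X$ a $\Pi^0_1$ subshift if $S^*\setminus\mathcal B(X)$ is recursively enumerable, and minimal if it is nonempty and its only subshifts are $\emptyset$ and $X$. The model-checking problem of $X$ for context-free languages is: given a context-free grammar generating a language $L\subset S^*$, decide whether $\mathcal B(X)\cap L\neq\emptyset$. A decision problem is $\Sigma^0_1$-complete if it is recursively enumerable and every recursively enumerable set is many-one reducible to it. Let $S=\{[_1,[_2,[_3,]_3,]_2,]_1\}$. The Dyck shift with labels $\{1,2,3\}$ is the set of all $x\in S^{\mathbb Z}$ such that recursively erasing factors $[_s]_s$ from finite words occurring in $x$ never yields a word with a factor $[_s]_{s'}$, $s\neq s'$. **Theorem.** There exists a minimal $\Pi^0_1$ subshift $X\subset S^{\mathbb Z}$, contained in the Dyck shift with labels $\{1,2,3\}$, whose model-checking problem for context-free languages is $\Sigma^0_1$-complete. Moreover, for the same $X$, the problem remains $\Sigma^0_1$-complete for languages of deterministic pushdown automata: given a deterministic pushdown automaton accepting (by final state) a language $L\subset S^*$, decide whether $\mathcal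 B(X)\cap L\neq\emptyset$. -/

import Mathlib

open SymbolicDynamics.FullShift (Subshift)

namespace ModelChecking

/-! ### Two-sided subshifts over a finite discrete alphabet -/

section Subshifts

variable {A : Type} [TopologicalSpace A]

/-- The word `x_i x_{i+1} ... x_{i+n-1}`. -/
def window (x : ℤ → A) (i : ℤ) (n : ℕ) : List A :=
  (List.range n).map fun k => x (i + (k : ℤ))

/-- `B(X)`: the finite words that occur in some point of `X`. -/
def language (X : Subshift A ℤ) : Language A :=
  {w | ∃ x ∈ X.carrier, ∃ i : ℤ, window x i w.length = w}

/-- `X` is nonempty and its only subshifts are the empty one and `X` itself. -/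
def IsMinimal (X : Subshift A ℤ) : Prop :=
  X.carrier.Nonempty ∧
    ∀ Y : Subshift A ℤ, Y.carrier ⊆ X.carrier → Y.carrier = ∅ ∨ Y.carrier = X.carrier

/-- The language of `X` is co-recursively-enumerable. -/
def IsPiZeroOne [Primcodable A] (X : Subshift A ℤ) : Prop :=
  REPred fun w : List A => w ∉ language X

end Subshifts

/-- Recursively enumerable, and every recursively enumerable set of natural numbers
many-one reduces to it. -/
def SigmaZeroOneComplete {α : Type} [Primcodable α] (p : α → Prop) : Prop :=
  REPred p ∧ ∀ q : ℕ → Prop, REPred q → ManyOneReducible q p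

/-! ### The Dyck shift with three labels -/

/-- `(s, true)` is the opening bracket with label `s`, `(s, false)` the closing one. -/
abbrev Bracket : Type := Fin 3 × Bool

/-- `v` arises from `u` by erasing one factor consisting of an opening bracket followed
immediately by the closing bracket with the same label. -/
def Erases (u v : List Bracket) : Prop :=
  ∃ (p q : List Bracket) (s : Fin 3), u = p ++ [(s, true), (s, false)] ++ q ∧ v = p ++ q

/-- Recursively erasing matched pairs never produces an opening bracket followed immediately by a
closing bracket with a different label. -/
def Matched (u : List Bracket) : Prop :=
  ∀ v, Relation.ReflTransGen Erases u v →
    ∀ s t : Fin 3, [(s, true), (t, false)] <:+: v → s = t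

/-- The Dyck shift with three labels. -/
def dyckShift : Set (ℤ → Bracket) :=
  {x | ∀ (i : ℤ) (n : ℕ), Matched (window x i n)}

/-! ### Finite descriptions of context-free grammars -/

/-- A context-free grammar with nonterminals in `ℕ`, as a finite object. -/
structure GrammarCode (A : Type) where
  initial : ℕ
  /-- Left-hand side and right-hand side of each rule. -/
  rules : List (ℕ × List (A ⊕ ℕ))

namespace GrammarCode

def equivProd (A : Type) : GrammarCode A ≃ ℕ × List (ℕ × List (A ⊕ ℕ)) where
  toFun g := (g.initial, g.rules)
  invFun p := ⟨p.1, p.2⟩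
  left_inv _ := rfl
  right_inv _ := rfl

instance (A : Type) [Primcodable A] : Primcodable (GrammarCode A) :=
  Primcodable.ofEquiv _ (equivProd A)

def toRule {A : Type} (r : ℕ × List (A ⊕ ℕ)) : ContextFreeRule A ℕ where
  input := r.1
  output := r.2.map (Sum.elim Symbol.terminal Symbol.nonterminal)

/-- The grammar described by a code. -/
def toGrammar {A : Type} [DecidableEq A] (g : GrammarCode A) : ContextFreeGrammar A where
  NT := ℕ
  initial := g.initial
  rules := (g.rules.map toRule).toFinset

end GrammarCode

/-! ### Pushdown automata -/

/-- In state `source`, with `top` on top of the stack, read `input` (`none`: read nothing),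
replace `top` by the word `push` (leftmost symbol topmost) and go to state `target`. -/
structure Transition (A : Type) where
  source : ℕ
  input : Option A
  top : ℕ
  target : ℕ
  push : List ℕ

/-- A pushdown automaton over `A`, with finitely many states and stack symbols taken from `ℕ`. -/
structure PDA (A : Type) where
  start : ℕ
  bottom : ℕ
  accepting : List ℕ
  transitions : List (Transition A)

namespace PDA

def transitionEquiv (A : Type) : Transition A ≃ ℕ × Option A × ℕ × ℕ × List ℕ where
  toFun t := (t.source, t.input, t.top, t.target, t.push)
  invFun p := ⟨p.1, p.2.1, p.2.2.1, p.2.2.2.1, p.2.2.2.2⟩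
  left_inv _ := rfl
  right_inv _ := rfl

instance (A : Type) [Primcodable A] : Primcodable (Transition A) :=
  Primcodable.ofEquiv _ (transitionEquiv A)

def equivProd (A : Type) : PDA A ≃ ℕ × ℕ × List ℕ × List (Transition A) where
  toFun M := (M.start, M.bottom, M.accepting, M.transitions)
  invFun p := ⟨p.1, p.2.1, p.2.2.1, p.2.2.2⟩
  left_inv _ := rfl
  right_inv _ := rfl

instance (A : Type) [Primcodable A] : Primcodable (PDA A) :=
  Primcodable.ofEquiv _ (equivProd A)

variable {A : Type}

/-- A configuration: state, unread input, stack (topmost symbol first). -/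
structure Config (A : Type) where
  state : ℕ
  unread : List A
  stack : List ℕ

/-- One move of the automaton. -/
def Step (M : PDA A) (c d : Config A) : Prop :=
  ∃ t ∈ M.transitions, ∃ γ : List ℕ,
    c.state = t.source ∧ c.unread = t.input.toList ++ d.unread ∧ c.stack = t.top :: γ ∧
      d.state = t.target ∧ d.stack = t.push ++ γ

/-- The language accepted by final state. -/
def accepts (M : PDA A) : Language A :=
  {w | ∃ q ∈ M.accepting, ∃ γ : List ℕ,
    Relation.ReflTransGen M.Step ⟨M.start, w, [M.bottom]⟩ ⟨q, [], γ⟩}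

/-- At most one transition applies in each configuration: two transitions with the same state and
the same top symbol that read the same letter, or one of which reads nothing, coincide. -/
def Deterministic (M : PDA A) : Prop :=
  ∀ t ∈ M.transitions, ∀ t' ∈ M.transitions, t.source = t'.source → t.top = t'.top →
    (t.input = t'.input ∨ t.input = none ∨ t'.input = none) → t = t'

theorem primrec_transitions [Primcodable A] : Primrec (transitions : PDA A → List (Transition A)) :=
  (Primrec.snd.comp <| Primrec.snd.comp <| Primrec.snd.comp <|
    Primrec.of_equiv (e := equivProd A))

theorem primrecPred_deterministic [Primcodable A] :
    PrimrecPred (Deterministic : PDA A → Prop) := by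
  have he : Primrec (transitionEquiv A) := Primrec.of_equiv (e := transitionEquiv A)
  have hs : Primrec (Transition.source : Transition A → ℕ) := Primrec.fst.comp he
  have hi : Primrec (Transition.input : Transition A → Option A) :=
    Primrec.fst.comp (Primrec.snd.comp he)
  have ht : Primrec (Transition.top : Transition A → ℕ) :=
    Primrec.fst.comp (Primrec.snd.comp (Primrec.snd.comp he))
  have h1 : PrimrecRel fun t t' : Transition A => t.source = t'.source :=
    Primrec.eq.comp (hs.comp Primrec.fst) (hs.comp Primrec.snd)
  have h2 : PrimrecRel fun t t' : Transition A => t.top = t'.top :=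
    Primrec.eq.comp (ht.comp Primrec.fst) (ht.comp Primrec.snd)
  have h3 : PrimrecRel fun t t' : Transition A => t.input = t'.input :=
    Primrec.eq.comp (hi.comp Primrec.fst) (hi.comp Primrec.snd)
  have h4 : PrimrecRel fun t _t' : Transition A => t.input = none :=
    Primrec.eq.comp (hi.comp Primrec.fst) (Primrec.const none)
  have h5 : PrimrecRel fun _t t' : Transition A => t'.input = none :=
    Primrec.eq.comp (hi.comp Primrec.snd) (Primrec.const none)
  have h6 : PrimrecRel fun t t' : Transition A => t = t' := Primrec.eq
  have hR : PrimrecRel fun t t' : Transition A => t.source = t'.source → t.top = t'.top →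
      (t.input = t'.input ∨ t.input = none ∨ t'.input = none) → t = t' :=
    (((PrimrecPred.not h1).or (PrimrecPred.not h2)).or
      ((PrimrecPred.not (h3.or (h4.or h5))).or h6)).of_eq fun p => by tauto
  have hL : PrimrecRel fun (L : List (Transition A)) (t' : Transition A) => ∀ t ∈ L,
      t.source = t'.source → t.top = t'.top →
      (t.input = t'.input ∨ t.input = none ∨ t'.input = none) → t = t' := hR.forall_mem_list
  have hL' : PrimrecRel fun (t' : Transition A) (L : List (Transition A)) => ∀ t ∈ L,
      t.source = t'.source → t.top = t'.top →
      (t.input = t'.input ∨ t.input = none ∨ t'.input = none) → t = t' :=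
    PrimrecRel.comp hL Primrec.snd Primrec.fst
  have hLL := hL'.forall_mem_list
  exact (PrimrecRel.comp hLL primrec_transitions primrec_transitions).of_eq fun M =>
    ⟨fun h t ht t' ht' => h t' ht' t ht, fun h t ht t' ht' => h t' ht' t ht⟩

end PDA

/-- Deterministic pushdown automata. -/
def DPDA (A : Type) : Type := {M : PDA A // M.Deterministic}

namespace DPDA

variable {A : Type}

open Classical in
noncomputable instance [Primcodable A] : Primcodable (DPDA A) :=
  Primcodable.subtype PDA.primrecPred_deterministic

def accepts (M : DPDA A) : Language A := M.1.accepts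

end DPDA

/-! ### Model-checking problems -/

/-- Given a context-free grammar, does some word that it generates occur in `X`? -/
def contextFreeModelChecking {A : Type} [TopologicalSpace A] [DecidableEq A] (X : Subshift A ℤ) :
    GrammarCode A → Prop :=
  fun g => ∃ w, w ∈ language X ∧ w ∈ g.toGrammar.language

/-- Given a deterministic pushdown automaton, does some word that it accepts occur in `X`? -/
def dpdaModelChecking {A : Type} [TopologicalSpace A] (X : Subshift A ℤ) : DPDA A → Prop :=
  fun M => ∃ w, w ∈ language X ∧ w ∈ M.accepts

end ModelChecking

/-! Write w_t for `word f t`. Then w_{t+1} = w_t [₀ C ]₀ w_t, where C consists of f(t) blocks [₁ w_t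
]₁ separated and flanked by copies of w_t, and X is the set of points all of whose factors occur in
some w_t.

For t ≤ t', w_{t'} is made of copies of w_t separated by single letters. Hence every long factor
contains w_t (`Interleaved.infix_of_long`), and X is minimal. If f ≥ 1, all four brackets in use
separate two copies of w_t already in w_{t+1}, so a word w occurs in X iff it occurs at level |w| +
1 (`infix_word_iff`). For primitive recursive f the language is therefore decidable, and both
problems are recursively enumerable.

Hardness lies in the range of f. All outermost brackets of w_t have label 0, so C has exactly f(t)
outermost brackets with label 1. Query n asks for a word [₀ u ]₀ with u balanced and exactly n
outermost label-1 brackets. Such a factor must be a node of the forest described by w_t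
(`Forest.hasNode_of_infix`), so it occurs in X iff n is a value of f
(`exists_reads_countTable_iff`). These words are read by a table that is both a Greibach normal form
grammar and a deterministic pushdown automaton. Taking `haltingSequence` for f makes its range
Σ⁰₁-complete. -/

namespace ModelChecking

/-! ### Words interleaved with single letters -/

section Interleaved

variable {A : Type} {P : A → Prop} {u v w x y : List A}
  {s : A}

/-- Copies of `w` separated by single letters satisfying `P`. -/
inductive Interleaved (P : A → Prop) (w : List A) : List A → Prop
  | base : Interleaved P w w
  | join {u v : List A} {s : A} : Interleaved P w u → P s → Interleaved P w v →
      Interleaved P w (u ++ s :: v)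

theorem Interleaved.prefix (h : Interleaved P w v) : w <+: v := by
  induction h with
  | base => exact List.prefix_rfl
  | join _ _ _ ih _ => exact ih.trans (List.prefix_append _ _)

theorem Interleaved.suffix (h : Interleaved P w v) : w <:+ v := by
  induction h with
  | base => exact List.suffix_rfl
  | join _ _ _ _ ih => exact ih.trans ((List.suffix_cons _ _).trans (List.suffix_append _ _))

theorem infix_append_cons_cases (h : u <:+: x ++ s :: y) :
    u <:+: x ∨ u <:+: y ∨ ∃ x' y', x' <:+ x ∧ y' <+: y ∧ u = x' ++ s :: y' := by
  rcases List.infix_append_iff.1 h with h | h | ⟨l₁, l₂, rfl, h₁, h₂⟩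
  · exact Or.inl h
  · rcases List.infix_cons_iff.1 h with h | h
    · rcases List.prefix_cons_iff.1 h with rfl | ⟨t, rfl, ht⟩
      · exact Or.inl (List.nil_infix)
      · exact Or.inr (Or.inr ⟨[], t, List.nil_suffix, ht, rfl⟩)
    · exact Or.inr (Or.inl h)
  · rcases List.prefix_cons_iff.1 h₂ with rfl | ⟨t, rfl, ht⟩
    · rw [List.append_nil]; exact Or.inl h₁.isInfix
    · exact Or.inr (Or.inr ⟨l₁, t, h₁, ht, rfl⟩)

/-- A factor crossing a separator has at least |w| letters on one side of it; there it contains the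
copy of w adjacent to that separator. -/
theorem Interleaved.infix_of_long (h : Interleaved P w v) (hu : u <:+: v)
    (hl : 2 * w.length + 1 ≤ u.length) : w <:+: u := by
  induction h with
  | base => have := hu.length_le; omega
  | join h₁ _ h₂ ih₁ ih₂ =>
    rcases infix_append_cons_cases hu with h | h | ⟨x', y', hx, hy, rfl⟩
    · exact ih₁ h
    · exact ih₂ h
    · simp only [List.length_append, List.length_cons] at hl
      rcases Nat.lt_or_ge x'.length w.length with h | h
      · have : w <+: y' := List.prefix_of_prefix_length_le h₂.prefix hy (by omega)
        exact this.isInfix.trans ((List.suffix_cons _ _).trans (List.suffix_append _ _)).isInfix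
      · have : w <:+ x' := List.suffix_of_suffix_length_le h₁.suffix hx h
        exact this.isInfix.trans (List.prefix_append _ _).isInfix

/-- A short factor crossing a separator has fewer than |w| letters on either side, so it sees only
the two adjacent copies of w. -/
theorem Interleaved.infix_of_short (h : Interleaved P w v) (hu : u <:+: v)
    (hl : u.length ≤ w.length) : u <:+: w ∨ ∃ s, P s ∧ u <:+: w ++ s :: w := by
  induction h with
  | base => exact Or.inl hu
  | @join p q s h₁ hs h₂ ih₁ ih₂ =>
    rcases infix_append_cons_cases hu with h | h | ⟨x', y', hx, hy, rfl⟩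
    · exact ih₁ h
    · exact ih₂ h
    · simp only [List.length_append, List.length_cons] at hl
      obtain ⟨a, ha⟩ : x' <:+ w := List.suffix_of_suffix_length_le hx h₁.suffix (by omega)
      obtain ⟨b, hb⟩ : y' <+: w := List.prefix_of_prefix_length_le hy h₂.prefix (by omega)
      refine Or.inr ⟨s, hs, a, b, ?_⟩
      calc a ++ (x' ++ s :: y') ++ b = (a ++ x') ++ s :: (y' ++ b) := by simp
        _ = w ++ s :: w := by rw [ha, hb]

end Interleaved

/-! ### The nested words -/

/-- `k` brackets with label `1`, each around a copy of `w`, separated by copies of `w`. -/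
def children (w : List Bracket) : ℕ → List Bracket
  | 0 => w
  | k + 1 => w ++ (1, true) :: (w ++ (1, false) :: children w k)

/-- The word of level `t`; its outermost bracket has `f t` children with label `1`. -/
def word (f : ℕ → ℕ) : ℕ → List Bracket
  | 0 => []
  | t + 1 => word f t ++ (0, true) :: (children (word f t) (f t) ++ (0, false) :: word f t)

/-- The brackets used in `word`. -/
def Used (s : Bracket) : Prop := s.1 ≠ 2

theorem interleaved_children {w v : List Bracket} (h : Interleaved Used w v) (k : ℕ) :
    Interleaved Used w (children v k) := by
  induction k with
  | zero => exact h
  | succ k ih => exact h.join (by simp [Used]) (h.join (by simp [Used]) ih)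

variable {f : ℕ → ℕ}

theorem interleaved_word_add (t k : ℕ) : Interleaved Used (word f t) (word f (t + k)) := by
  induction k with
  | zero => exact .base
  | succ k ih =>
    exact ih.join (by simp [Used]) ((interleaved_children ih _).join (by simp [Used]) ih)

theorem interleaved_word {t t' : ℕ} (h : t ≤ t') : Interleaved Used (word f t) (word f t') := by
  obtain ⟨k, rfl⟩ := Nat.exists_eq_add_of_le h
  exact interleaved_word_add t k

theorem word_infix {t t' : ℕ} (h : t ≤ t') : word f t <:+: word f t' :=
  (interleaved_word h).prefix.isInfix

theorem prefix_children (w : List Bracket) (k : ℕ) : w <+: children w k :=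
  (interleaved_children .base k).prefix

theorem suffix_children (w : List Bracket) (k : ℕ) : w <:+ children w k :=
  (interleaved_children .base k).suffix

theorem le_length_word (t : ℕ) : t ≤ (word f t).length := by
  induction t with
  | zero => exact Nat.zero_le _
  | succ t ih => simp only [word, List.length_append, List.length_cons]; omega

/-- The 0-brackets touch the two ends of the children block, which begins and ends with w_t. The
1-brackets appear inside the block as soon as there is one child. -/
theorem infix_word_succ (hf : ∀ t, 1 ≤ f t) (t : ℕ) {s : Bracket} (hs : Used s) :
    word f t ++ s :: word f t <:+: word f (t + 1) := by
  obtain ⟨k, hk⟩ := Nat.exists_eq_add_of_le' (hf t)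
  obtain ⟨b, hb⟩ := prefix_children (word f t) (f t)
  obtain ⟨a, ha⟩ := suffix_children (word f t) (f t)
  obtain ⟨d, hd⟩ := prefix_children (word f t) k
  have h1 : children (word f t) (f t) <:+: word f (t + 1) :=
    ⟨word f t ++ [(0, true)], (0, false) :: word f t, by simp [word]⟩
  have h2 : children (word f t) (f t) = word f t ++ (1, true) :: (word f t ++ (1, false) ::
    children (word f t) k) := by rw [hk]; rfl
  rw [h2] at h1
  obtain ⟨s, b'⟩ := s
  fin_cases s <;> cases b'
  · refine ⟨word f t ++ (0, true) :: a, [], ?_⟩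
    simp only [word, ← ha]; simp
  · refine ⟨[], b ++ (0, false) :: word f t, ?_⟩
    simp only [word, ← hb]; simp
  · refine List.IsInfix.trans ⟨word f t ++ [(1, true)], d, ?_⟩ h1
    simp [← hd]
  · exact List.IsInfix.trans ⟨[], (1, false) :: children (word f t) k, by simp⟩ h1
  · simp [Used] at hs
  · simp [Used] at hs

/-- Bounding the level makes the language decidable: w_{|w|} has length at least |w|, so
`Interleaved.infix_of_short` applies with it as the repeated word. -/
theorem infix_word_iff (hf : ∀ t, 1 ≤ f t) (w : List Bracket) :
    (∃ t, w <:+: word f t) ↔ w <:+: word f (w.length + 1) := by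
  refine ⟨fun ⟨t, ht⟩ => ?_, fun h => ⟨_, h⟩⟩
  have h1 : w <:+: word f (t + w.length) := ht.trans (word_infix (Nat.le_add_right _ _))
  rcases (interleaved_word (Nat.le_add_left _ _)).infix_of_short h1 (le_length_word _) with
    h | ⟨s, hs, h⟩
  · exact h.trans (word_infix (Nat.le_succ _))
  · exact h.trans (infix_word_succ hf _ hs)

/-! ### The subshift -/

theorem window_eq_map {A : Type} (x : ℤ → A) (i : ℤ) (n : ℕ) :
    window x i n = (List.range n).map fun k : ℕ => x (i + (k : ℤ)) := by
  simp [window, List.map_eq_flatMap, List.flatMap_assoc]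

theorem window_length {A : Type} (x : ℤ → A) (i : ℤ) (n : ℕ) : (window x i n).length = n := by
  simp [window_eq_map]

theorem window_add {A : Type} (x : ℤ → A) (i : ℤ) (m n : ℕ) :
    window x i (m + n) = window x i m ++ window x (i + m) n := by
  simp [window_eq_map, List.range_add, Function.comp_def, add_assoc]

theorem window_shift {A : Type} (x : ℤ → A) (g i : ℤ) (n : ℕ) :
    window (SymbolicDynamics.FullShift.shift g x) i n = window x (g + i) n := by
  simp [window_eq_map, SymbolicDynamics.FullShift.shift, add_assoc]

theorem window_eq_iff {A : Type} {x y : ℤ → A} {i j : ℤ} {n : ℕ} :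
    window x i n = window y j n ↔ ∀ k : ℕ, k < n → x (i + k) = y (j + k) := by
  simp [window_eq_map, List.map_inj_left]

theorem window_infix {A : Type} {x : ℤ → A} {i j : ℤ} {m n : ℕ} (h : i ≤ j)
    (h' : j + m ≤ i + n) : window x j m <:+: window x i n := by
  obtain ⟨k, rfl⟩ := Int.le.dest h
  obtain ⟨l, rfl⟩ : ∃ l, n = k + (m + l) := ⟨n - k - m, by omega⟩
  rw [window_add, window_add]
  exact ⟨_, _, by rw [List.append_assoc]⟩

theorem exists_window_of_infix {A : Type} {x : ℤ → A} {i : ℤ} {n : ℕ} {w : List A}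
    (h : w <:+: window x i n) : ∃ j, window x j w.length = w := by
  obtain ⟨p, q, hpq⟩ := h
  have hn : n = p.length + (w.length + q.length) := by
    rw [← window_length x i n, ← hpq]; simp
  subst hn
  rw [window_add, window_add, List.append_assoc] at hpq
  have h1 := List.append_inj hpq (window_length _ _ _).symm
  have h2 := List.append_inj h1.2 (window_length _ _ _).symm
  exact ⟨_, h2.1.symm⟩

open SymbolicDynamics.FullShift (Subshift shift)

/-- The points all of whose factors occur in the words of a sequence. -/
def factorShift {A : Type} [TopologicalSpace A] [DiscreteTopology A] (W : ℕ → List A) :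
    Subshift A ℤ where
  carrier := {x | ∀ (i : ℤ) (n : ℕ), ∃ t, window x i n <:+: W t}
  isClosed := by
    simp only [Set.ofPred_forall]
    refine isClosed_iInter fun i => isClosed_iInter fun n => ?_
    -- The condition on one window involves finitely many coordinates: it is the preimage of a
    -- subset of a discrete space.
    have hc : Continuous fun x : ℤ → A => fun k : Fin n => x (i + (k : ℕ)) := by fun_prop
    have : {x : ℤ → A | ∃ t, window x i n <:+: W t} =
        (fun x : ℤ → A => fun k : Fin n => x (i + (k : ℕ))) ⁻¹'
          {y | ∃ t, List.ofFn y <:+: W t} := by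
      ext x
      have : window x i n = List.ofFn fun k : Fin n => x (i + (k : ℕ)) := by
        apply List.ext_getElem <;> simp [window_eq_map]
      simp [this]
    rw [this]
    exact (isClosed_discrete _).preimage hc
  mapsTo := by
    intro g x hx i n
    obtain ⟨t, ht⟩ := hx (g + i) n
    exact ⟨t, by rwa [window_shift]⟩

/-! ### A point of the subshift, as a two-sided limit -/

/-- The position of a distinguished occurrence of all previous words in `word f t`. -/
def center (f : ℕ → ℕ) : ℕ → ℕ
  | 0 => 0
  | t + 1 => (word f t).length + 1 + center f t

/-- The distinguished copy of w_t in w_{t+1} is the one that opens the children block. It has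
letters on both sides, so the room around the center grows without bound in both directions. -/
theorem le_center (t : ℕ) : t ≤ center f t := by
  induction t with
  | zero => exact le_rfl
  | succ t ih => simp only [center]; omega

theorem center_add_le_length (t : ℕ) : center f t + t ≤ (word f t).length := by
  induction t with
  | zero => simp [center]
  | succ t ih =>
    have := (prefix_children (word f t) (f t)).length_le
    simp only [center, word, List.length_append, List.length_cons]; omega

/-- The two-sided limit of the words `word f t` around `center f t`. -/
def limitPoint (f : ℕ → ℕ) (i : ℤ) : Bracket :=
  (word f (i.natAbs + 1)).getD (center f (i.natAbs + 1) + i).toNat (0, true)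

theorem getElem?_word_succ {t k : ℕ} (h : k < (word f t).length) :
    (word f (t + 1))[(word f t).length + 1 + k]? = (word f t)[k]? := by
  obtain ⟨b, hb⟩ := prefix_children (word f t) (f t)
  simp only [word, ← hb]
  rw [List.getElem?_append_right (by omega)]
  have : (word f t).length + 1 + k - (word f t).length = k + 1 := by omega
  rw [this, List.getElem?_cons_succ, List.append_assoc, List.getElem?_append_left h]

theorem getElem?_word_center {t k : ℕ} {i : ℤ} (hk : (k : ℤ) = center f t + i)
    (h : k < (word f t).length) : (word f t)[k]? = some (limitPoint f i) := by
  -- Coherence: once offset i lies inside w_t, its letter is the same at all higher levels.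
  have key : ∀ d t k k' : ℕ, (k : ℤ) = center f t + i → (k' : ℤ) = center f (t + d) + i →
      k < (word f t).length → (word f (t + d))[k']? = (word f t)[k]? := by
    intro d t
    induction d with
    | zero =>
      intro k k' h1 h2 _
      have : k = k' := by rw [Nat.add_zero] at h2; omega
      rw [this, Nat.add_zero]
    | succ d ih =>
      intro k k' h1 h2 h3
      have e : center f (t + (d + 1)) = (word f (t + d)).length + 1 + center f (t + d) := rfl
      rw [e] at h2
      have hc : center f t ≤ center f (t + d) := by
        clear * -
        induction d with
        | zero => exact le_rfl
        | succ d ih => refine ih.trans ?_; rw [← Nat.add_assoc]; simp only [center]; omega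
      obtain ⟨m, hm⟩ : ∃ m : ℕ, (m : ℤ) = center f (t + d) + i :=
        ⟨(center f (t + d) + i).toNat, by omega⟩
      have h4 := ih k m h1 hm h3
      have h5 : m < (word f (t + d)).length := by
        rw [List.getElem?_eq_getElem h3] at h4
        exact (List.getElem?_eq_some_iff.1 h4).1
      rw [← h4, ← getElem?_word_succ h5]
      have : k' = (word f (t + d)).length + 1 + m := by push_cast at h2; omega
      rw [this]; rfl
  set t₀ := i.natAbs + 1 with ht₀
  have hc := le_center (f := f) t₀
  have hl := center_add_le_length (f := f) t₀
  obtain ⟨k₀, hk₀⟩ : ∃ m : ℕ, (m : ℤ) = center f t₀ + i := ⟨(center f t₀ + i).toNat, by omega⟩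
  -- At level |i| + 1 the offset i lies inside the word, so the default value in `limitPoint` is
  -- never taken.
  have hlt : k₀ < (word f t₀).length := by omega
  have h0 : (word f t₀)[k₀]? = some (limitPoint f i) := by
    have : (center f t₀ + i).toNat = k₀ := by omega
    rw [limitPoint, ← ht₀, this, List.getElem?_eq_getElem hlt, List.getD_eq_getElem _ _ hlt]
  rw [← h0]
  rcases le_total t t₀ with hle | hle
  · obtain ⟨d, hd⟩ := Nat.exists_eq_add_of_le hle
    rw [hd] at hk₀ ⊢
    exact (key d t k k₀ hk hk₀ h).symm
  · obtain ⟨d, rfl⟩ := Nat.exists_eq_add_of_le hle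
    exact key d t₀ k₀ k hk₀ hk hlt

theorem window_limitPoint (t : ℕ) :
    window (limitPoint f) (-(center f t)) (word f t).length = word f t := by
  apply List.ext_getElem?
  intro k
  rcases Nat.lt_or_ge k (word f t).length with h | h
  · rw [getElem?_word_center (i := -(center f t) + k) (by ring) h]
    simp [window_eq_map, h]
  · rw [List.getElem?_eq_none h, List.getElem?_eq_none (by rwa [window_length])]

theorem limitPoint_mem : limitPoint f ∈ (factorShift (word f)).carrier := by
  intro i n
  refine ⟨i.natAbs + n, ?_⟩
  rw [← window_limitPoint]
  have := le_center (f := f) (i.natAbs + n)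
  have := center_add_le_length (f := f) (i.natAbs + n)
  exact window_infix (by omega) (by omega)

theorem mem_language_factorShift_word {w : List Bracket} :
    w ∈ language (factorShift (word f)) ↔ ∃ t, w <:+: word f t := by
  constructor
  · rintro ⟨x, hx, i, hi⟩
    obtain ⟨t, ht⟩ := hx i w.length
    exact ⟨t, hi ▸ ht⟩
  · rintro ⟨t, ht⟩
    rw [← window_limitPoint] at ht
    exact ⟨_, limitPoint_mem, exists_window_of_infix ht⟩

/-- A central window of x lies in some w_t, and every long window of a point y of Y contains w_t. So
shifts of y agree with x on arbitrarily large windows, and x lies in the closed set Y. -/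
theorem isMinimal_factorShift_word : IsMinimal (factorShift (word f)) := by
  refine ⟨⟨_, limitPoint_mem⟩, fun Y hY => ?_⟩
  rcases Set.eq_empty_or_nonempty Y.carrier with h | ⟨y, hy⟩
  · exact Or.inl h
  refine Or.inr (hY.antisymm fun x hx => ?_)
  have key : ∀ N : ℕ, ∃ z ∈ Y.carrier, window z (-N) (2 * N + 1) = window x (-N) (2 * N + 1) := by
    intro N
    obtain ⟨t, ht⟩ := hx (-N) (2 * N + 1)
    obtain ⟨t', ht'⟩ := hY hy 0 (2 * (word f t).length + 1)
    -- Passing to level t + t' keeps the window of y as a factor and puts the level above t.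
    have h1 := (interleaved_word (Nat.le_add_right t t')).infix_of_long
      (ht'.trans (word_infix (Nat.le_add_left t' t))) (by rw [window_length])
    obtain ⟨j, hj⟩ := exists_window_of_infix (ht.trans h1)
    rw [window_length] at hj
    refine ⟨shift (j + N) y, Y.mapsTo _ hy, ?_⟩
    rw [window_shift, ← hj]
    congr 1; ring
  choose z hz hzx using key
  refine Y.isClosed.mem_of_tendsto (b := Filter.atTop) (f := z) ?_ (Filter.Eventually.of_forall hz)
  rw [tendsto_pi_nhds]
  intro i
  refine tendsto_const_nhds.congr' ?_
  filter_upwards [Filter.eventually_ge_atTop i.natAbs] with N hN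
  have := window_eq_iff.1 (hzx N) (i + N).toNat (by omega)
  have e : -(N : ℤ) + ((i + N).toNat : ℤ) = i := by omega
  rw [e] at this
  exact this.symm

/-! ### Membership in the Dyck shift -/

/-- Read a word from left to right while keeping the stack of unmatched opening brackets;
closing brackets on the empty stack are rejected. -/
def reduce : List Bracket → List (Fin 3) → Option (List (Fin 3))
  | [], st => some st
  | (s, true) :: w, st => reduce w (s :: st)
  | (_, false) :: _, [] => none
  | (s, false) :: w, t :: st => if s = t then reduce w st else none

theorem reduce_append (u v : List Bracket) (st : List (Fin 3)) :
    reduce (u ++ v) st = (reduce u st).bind (reduce v) := by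
  induction u generalizing st with
  | nil => rfl
  | cons a u ih =>
    obtain ⟨s, _ | _⟩ := a
    · cases st with
      | nil => rfl
      | cons t st =>
        simp only [List.cons_append, reduce]
        split_ifs
        · exact ih st
        · rfl
    · exact ih _

/-- Erasing a matched pair does not change the outcome of `reduce`, while an adjacent mismatched
pair makes it fail from every stack. -/
theorem matched_of_reduce {u : List Bracket} {st : List (Fin 3)} (h : reduce u st ≠ none) :
    Matched u := by
  intro v hv s t hst
  have hv' : reduce v st = reduce u st := by
    clear hst
    induction hv with
    | refl => rfl
    | tail _ hstep ih =>
      obtain ⟨p, q, s, rfl, rfl⟩ := hstep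
      rw [← ih]
      simp only [reduce_append]
      congr 1
      cases reduce p st <;> simp [reduce]
  rw [← hv'] at h
  obtain ⟨p, q, rfl⟩ := hst
  by_contra hne
  apply h
  simp only [reduce_append]
  cases reduce p st <;> simp [reduce, Ne.symm hne]

/-- The factor is reduced from the stack that the preceding letters leave; this is why
`matched_of_reduce` allows any initial stack. -/
theorem matched_of_infix {u v : List Bracket} (h : u <:+: v) (hv : reduce v [] = some []) :
    Matched u := by
  obtain ⟨p, q, rfl⟩ := h
  simp only [reduce_append] at hv
  cases hp : reduce p [] with
  | none => simp [hp] at hv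
  | some st =>
    refine matched_of_reduce (st := st) fun hu => ?_
    simp [hp, hu] at hv

/-! ### Forests of brackets -/

/-- Finite ordered forests whose nodes carry labels: the first tree has root label `l` and
children `c`, and `r` consists of the remaining trees. -/
inductive Forest
  | nil : Forest
  | node (l : Fin 3) (c r : Forest) : Forest

namespace Forest

/-- The balanced word of a forest. -/
def flatten : Forest → List Bracket
  | nil => []
  | node l c r => (l, true) :: (c.flatten ++ (l, false) :: r.flatten)

def append : Forest → Forest → Forest
  | nil, G => G
  | node l c r, G => node l c (r.append G)

/-- The number of roots with label `1`. -/
def ones : Forest → ℕ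
  | nil => 0
  | node l _ r => (if l = 1 then 1 else 0) + r.ones

/-- Some node of the forest has label `a` and children `d`. -/
def HasNode (a : Fin 3) (d : Forest) : Forest → Prop
  | nil => False
  | node l c r => (a = l ∧ d = c) ∨ HasNode a d c ∨ HasNode a d r

theorem flatten_append (F G : Forest) : (F.append G).flatten = F.flatten ++ G.flatten := by
  induction F with
  | nil => rfl
  | node l c r _ ih => simp [append, flatten, ih]

theorem ones_append (F G : Forest) : (F.append G).ones = F.ones + G.ones := by
  induction F with
  | nil => simp [append, ones]
  | node l c r _ ih => simp [append, ones, ih, add_assoc]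

theorem hasNode_append {a : Fin 3} {d F G : Forest} :
    HasNode a d (F.append G) ↔ HasNode a d F ∨ HasNode a d G := by
  induction F with
  | nil => simp [append, HasNode]
  | node l c r _ ih => simp only [append, HasNode, ih]; tauto

theorem reduce_flatten (F : Forest) (st : List (Fin 3)) : reduce F.flatten st = some st := by
  induction F generalizing st with
  | nil => rfl
  | node l c r ihc ihr => simp [flatten, reduce, reduce_append, ihc, ihr]

/-- Unique parsing: the first unmatched closing bracket shows where the word of the forest ends. -/
theorem flatten_append_close_inj {F G : Forest} {s t : Fin 3} {u v : List Bracket}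
    (h : F.flatten ++ (s, false) :: u = G.flatten ++ (t, false) :: v) :
    F = G ∧ s = t ∧ u = v := by
  induction F generalizing G s t u v with
  | nil =>
    cases G with
    | nil => simpa [flatten] using h
    | node => simp [flatten] at h
  | node l c r ihc ihr =>
    cases G with
    | nil => simp [flatten] at h
    | node l' c' r' =>
      simp only [flatten, List.cons_append, List.append_assoc, List.cons.injEq, Prod.mk.injEq,
        and_true] at h
      obtain ⟨rfl, h⟩ := h
      obtain ⟨rfl, -, h⟩ := ihc h
      obtain ⟨rfl, rfl, rfl⟩ := ihr h
      exact ⟨rfl, rfl, rfl⟩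

end Forest

/-! ### Heights and factors of balanced words -/

/-- The number of opening brackets minus the number of closing brackets. -/
def height : List Bracket → ℤ
  | [] => 0
  | (_, true) :: w => 1 + height w
  | (_, false) :: w => -1 + height w

theorem height_append (u v : List Bracket) : height (u ++ v) = height u + height v := by
  induction u with
  | nil => simp [height]
  | cons a u ih => obtain ⟨s, _ | _⟩ := a <;> simp [height, ih, add_assoc]

namespace Forest

theorem height_flatten (F : Forest) : height F.flatten = 0 := by
  induction F with
  | nil => rfl
  | node l c r ihc ihr => simp [flatten, height, height_append, ihc, ihr]

theorem height_prefix_nonneg {F : Forest} {u : List Bracket} (h : u <+: F.flatten) :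
    0 ≤ height u := by
  induction F generalizing u with
  | nil => rw [List.prefix_nil.1 h]; rfl
  | node l c r ihc ihr =>
    rcases List.prefix_cons_iff.1 h with rfl | ⟨u, rfl, q, hq⟩
    · rfl
    rcases List.append_eq_append_iff.1 hq with ⟨a, ha, -⟩ | ⟨u, rfl, hu⟩
    · have := ihc ⟨a, ha.symm⟩
      simp only [height]; omega
    rcases List.prefix_cons_iff.1 ⟨q, hu.symm⟩ with rfl | ⟨u, rfl, h'⟩
    · simp [height, height_flatten]
    · have := ihr h'
      simp only [height, height_append, height_flatten]; omega

theorem height_suffix_nonpos {F : Forest} {u : List Bracket} (h : u <:+ F.flatten) :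
    height u ≤ 0 := by
  obtain ⟨p, hp⟩ := h
  have h1 := height_prefix_nonneg (F := F) ⟨u, hp⟩
  have h2 := height_flatten F
  rw [← hp, height_append] at h2
  omega

/-- If the factor covered the displayed closing bracket, its part before that bracket would be an
opening bracket followed by a prefix of `G.flatten`, of height at least 1. It would also be a suffix
of `F.flatten`, of height at most 0. -/
theorem infix_close_cases {F G : Forest} {s l : Fin 3} {v : List Bracket}
    (h : (s, true) :: (G.flatten ++ [(s, false)]) <:+: F.flatten ++ (l, false) :: v) :
    (s, true) :: (G.flatten ++ [(s, false)]) <:+: F.flatten ∨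
      (s, true) :: (G.flatten ++ [(s, false)]) <:+: v := by
  rcases infix_append_cons_cases h with h | h | ⟨x', y', hx, -, h⟩
  · exact Or.inl h
  · exact Or.inr h
  · exfalso
    cases x' with
    | nil => simp at h
    | cons a x' =>
      simp only [List.cons_append, List.cons.injEq] at h
      obtain ⟨rfl, h⟩ := h
      have h1 := height_suffix_nonpos hx
      have h2 : x' <+: G.flatten := by
        have h3 : x' <+: G.flatten ++ [(s, false)] := ⟨_, h.symm⟩
        rcases List.prefix_concat_iff.1 h3 with h4 | h4
        · rw [h4] at h
          simp at h
        · exact h4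
      have := height_prefix_nonneg h2
      simp only [height] at h1
      omega

/-- Either the factor starts at the first bracket of the forest, and unique parsing identifies G, or
`infix_close_cases` confines it to one of the two subforests. -/
theorem hasNode_of_infix {F G : Forest} {s : Fin 3}
    (h : (s, true) :: (G.flatten ++ [(s, false)]) <:+: F.flatten) : HasNode s G F := by
  induction F with
  | nil => simp [flatten] at h
  | node l c r ihc ihr =>
    rcases List.infix_cons_iff.1 h with ⟨q, hq⟩ | h
    · simp only [List.cons_append, List.cons.injEq, Prod.mk.injEq, and_true, List.append_assoc,
        List.nil_append] at hq
      exact Or.inl ⟨hq.1, (flatten_append_close_inj hq.2).1⟩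
    · rcases infix_close_cases h with h | h
      · exact Or.inr (Or.inl (ihc h))
      · exact Or.inr (Or.inr (ihr h))

/-! ### The forests of the nested words -/

/-- The forest of `children`. -/
def ofChildren (F : Forest) : ℕ → Forest
  | 0 => F
  | k + 1 => F.append (node 1 F (ofChildren F k))

/-- The forest of `word`. -/
def ofWord (f : ℕ → ℕ) : ℕ → Forest
  | 0 => nil
  | t + 1 => (ofWord f t).append (node 0 (ofChildren (ofWord f t) (f t)) (ofWord f t))

theorem flatten_ofChildren (F : Forest) (k : ℕ) :
    (ofChildren F k).flatten = children F.flatten k := by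
  induction k with
  | zero => rfl
  | succ k ih => simp [ofChildren, children, flatten_append, flatten, ih]

theorem flatten_ofWord (f : ℕ → ℕ) (t : ℕ) : (ofWord f t).flatten = word f t := by
  induction t with
  | zero => rfl
  | succ t ih => simp [ofWord, word, flatten_append, flatten, flatten_ofChildren, ih]

theorem ones_ofChildren {F : Forest} (h : F.ones = 0) (k : ℕ) : (ofChildren F k).ones = k := by
  induction k with
  | zero => exact h
  | succ k ih => simp [ofChildren, ones_append, ones, h, ih, add_comm]

/-- Copies of w_t add nothing to the count of label-1 roots, so in a children block exactly the
separating 1-brackets are counted. -/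
theorem ones_ofWord (f : ℕ → ℕ) (t : ℕ) : (ofWord f t).ones = 0 := by
  induction t with
  | zero => rfl
  | succ t ih => simp [ofWord, ones_append, ones, ih]

theorem HasNode.of_ofChildren {F d : Forest} {k : ℕ} (h : HasNode 0 d (ofChildren F k)) :
    HasNode 0 d F := by
  induction k with
  | zero => exact h
  | succ k ih =>
    rcases hasNode_append.1 h with h | ⟨h, -⟩ | h | h
    · exact h
    · simp at h
    · exact h
    · exact ih h

/-- Each level creates one new kind of 0-node, with f(t) label-1 children; all others lie in copies
of the previous word. -/
theorem HasNode.of_ofWord {f : ℕ → ℕ} {d : Forest} {t : ℕ} (h : HasNode 0 d (ofWord f t)) :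
    ∃ s, f s = d.ones := by
  induction t with
  | zero => exact h.elim
  | succ t ih =>
    rcases hasNode_append.1 h with h | ⟨-, rfl⟩ | h | h
    · exact ih h
    · exact ⟨t, (ones_ofChildren (ones_ofWord f t) _).symm⟩
    · exact ih h.of_ofChildren
    · exact ih h

end Forest

theorem exists_eq_ones_of_infix_word {f : ℕ → ℕ} {t : ℕ} {F : Forest}
    (h : (0, true) :: (F.flatten ++ [(0, false)]) <:+: word f t) : ∃ s, f s = F.ones := by
  rw [← Forest.flatten_ofWord] at h
  exact (Forest.hasNode_of_infix h).of_ofWord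

theorem factorShift_word_subset_dyckShift (f : ℕ → ℕ) :
    (factorShift (word f)).carrier ⊆ dyckShift := by
  intro x hx i n
  obtain ⟨t, ht⟩ := hx i n
  refine matched_of_infix ht ?_
  rw [← Forest.flatten_ofWord, Forest.reduce_flatten]

/-! ### Tables: grammars in Greibach normal form and their pushdown automata -/

section Tables

variable {A : Type} {T : List (A × ℕ × List ℕ)}

/-- With stack `γ`, the table `T` can read the word: an entry `(a, X, γ)` allows to read `a` when
`X` is on top of the stack, and replaces `X` by `γ`. -/
inductive Reads (T : List (A × ℕ × List ℕ)) : List ℕ → List A → Prop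
  | nil : Reads T [] []
  | cons {a : A} {X : ℕ} {γ δ : List ℕ} {w : List A} : (a, X, γ) ∈ T → Reads T (γ ++ δ) w →
      Reads T (X :: δ) (a :: w)

/-- `Reads` for sentential forms. -/
inductive ReadsForm (T : List (A × ℕ × List ℕ)) : List (Symbol A ℕ) → List A → Prop
  | nil : ReadsForm T [] []
  | terminal {a : A} {α : List (Symbol A ℕ)} {w : List A} : ReadsForm T α w →
      ReadsForm T (.terminal a :: α) (a :: w)
  | nonterminal {a : A} {X : ℕ} {γ : List ℕ} {α : List (Symbol A ℕ)} {w : List A} :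
      (a, X, γ) ∈ T → ReadsForm T (γ.map .nonterminal ++ α) w →
      ReadsForm T (.nonterminal X :: α) (a :: w)

theorem readsForm_terminal (w : List A) : ReadsForm T (w.map .terminal) w := by
  induction w with
  | nil => exact .nil
  | cons a w ih => exact .terminal ih

theorem ReadsForm.reads {γ : List ℕ} {w : List A} (h : ReadsForm T (γ.map .nonterminal) w) :
    Reads T γ w := by
  generalize hα : γ.map Symbol.nonterminal = α at h
  induction h generalizing γ with
  | nil => rw [List.map_eq_nil_iff.1 hα]; exact .nil
  | terminal _ _ => cases γ <;> simp at hα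
  | nonterminal hT _ ih =>
    cases γ with
    | nil => simp at hα
    | cons Y γ =>
      simp only [List.map_cons, List.cons.injEq, Symbol.nonterminal.injEq] at hα
      obtain ⟨rfl, rfl⟩ := hα
      exact .cons hT (ih (by simp))

/-- A grammar step at any position can be undone. Working back from the terminal word, this turns
arbitrary derivations, not only leftmost ones, into runs of the table. -/
theorem ReadsForm.of_rewrite {a : A} {X : ℕ} {γ : List ℕ} (hT : (a, X, γ) ∈ T) {w : List A}
    {p q : List (Symbol A ℕ)}
    (h : ReadsForm T (p ++ (.terminal a :: γ.map .nonterminal) ++ q) w) :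
    ReadsForm T (p ++ [.nonterminal X] ++ q) w := by
  generalize hα : p ++ (Symbol.terminal a :: γ.map .nonterminal) ++ q = α at h
  induction h generalizing p with
  | nil => simp at hα
  | @terminal b α w h ih =>
    cases p with
    | nil =>
      simp only [List.nil_append, List.cons_append, List.cons.injEq, Symbol.terminal.injEq] at hα
      obtain ⟨rfl, rfl⟩ := hα
      exact .nonterminal hT h
    | cons b' p =>
      simp only [List.cons_append, List.cons.injEq] at hα
      obtain ⟨rfl, rfl⟩ := hα
      exact .terminal (ih rfl)
  | @nonterminal b Y δ α w hY h ih =>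
    cases p with
    | nil => simp at hα
    | cons b' p =>
      simp only [List.cons_append, List.cons.injEq] at hα
      obtain ⟨rfl, rfl⟩ := hα
      refine .nonterminal hY ?_
      have := ih (p := δ.map .nonterminal ++ p) (by simp)
      simpa using this

/-- The grammar with the rules `X → a γ` for the entries `(a, X, γ)` of the table. -/
def tableGrammar (T : List (A × ℕ × List ℕ)) (X : ℕ) : GrammarCode A where
  initial := X
  rules := T.map fun r => (r.2.1, Sum.inl r.1 :: r.2.2.map Sum.inr)

theorem mem_rules_toGrammar [DecidableEq A] {g : GrammarCode A} {r : ContextFreeRule A ℕ} :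
    r ∈ g.toGrammar.rules ↔ ∃ e ∈ g.rules, GrammarCode.toRule e = r :=
  List.mem_toFinset.trans List.mem_map

theorem mem_rules_tableGrammar [DecidableEq A] {X : ℕ} {r : ContextFreeRule A ℕ} :
    r ∈ (tableGrammar T X).toGrammar.rules ↔
      ∃ e ∈ T, r = ⟨e.2.1, .terminal e.1 :: e.2.2.map .nonterminal⟩ := by
  rw [mem_rules_toGrammar]
  simp only [tableGrammar, List.mem_map, exists_exists_and_eq_and]
  refine exists_congr fun e => and_congr_right fun _ => ?_
  rw [eq_comm]
  simp [GrammarCode.toRule, Function.comp_def]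

theorem Reads.derives [DecidableEq A] {X : ℕ} {γ : List ℕ} {w : List A} (h : Reads T γ w) :
    (tableGrammar T X).toGrammar.Derives (γ.map .nonterminal) (w.map .terminal) := by
  induction h with
  | nil => exact Relation.ReflTransGen.refl
  | @cons a Y γ δ w hT _ ih =>
    refine Relation.ReflTransGen.head (b := .terminal a :: (γ ++ δ).map .nonterminal) ?_ ?_
    · refine ⟨_, mem_rules_tableGrammar.2 ⟨_, hT, rfl⟩, ?_⟩
      have h : (⟨Y, .terminal a :: γ.map .nonterminal⟩ : ContextFreeRule A ℕ).Rewrites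
          ((Y :: δ).map .nonterminal) (.terminal a :: (γ ++ δ).map .nonterminal) := by
        rw [List.map_append]
        exact .head _
      exact h
    · exact ih.append_left [.terminal a]

theorem mem_language_tableGrammar [DecidableEq A] {X : ℕ} {w : List A} :
    w ∈ (tableGrammar T X).toGrammar.language ↔ Reads T [X] w := by
  refine ⟨fun h => ReadsForm.reads ?_, fun h => h.derives⟩
  have key : ∀ {α β}, (tableGrammar T X).toGrammar.Derives α β → ReadsForm T β w →
      ReadsForm T α w := by
    intro α β h hβ
    induction h with
    | refl => exact hβ
    | tail _ hstep ih =>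
      obtain ⟨r, hr, hrw⟩ := hstep
      obtain ⟨e, he, rfl⟩ := mem_rules_tableGrammar.1 hr
      obtain ⟨p, q, rfl, rfl⟩ := hrw.exists_parts
      exact ih (hβ.of_rewrite he)
  exact key h (readsForm_terminal w)

/-! ### From tables to pushdown automata -/

/-- The pushdown automaton of a table with initial stack `X` above the bottom symbol `0`. -/
def tablePDA (T : List (A × ℕ × List ℕ)) (X : ℕ) : PDA A where
  start := 0
  bottom := 0
  accepting := [2]
  transitions := ⟨0, none, 0, 1, [X, 0]⟩ :: ⟨1, none, 0, 2, []⟩ ::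
    T.map fun r => ⟨1, some r.1, r.2.1, 1, r.2.2⟩

/-- The silent move from state 1 to state 2 needs the bottom symbol 0 on top, so it cannot compete
with table entries whose top symbols are nonzero. -/
theorem deterministic_tablePDA {X : ℕ} (h₀ : ∀ r ∈ T, r.2.1 ≠ 0)
    (h : ∀ r ∈ T, ∀ r' ∈ T, r.1 = r'.1 → r.2.1 = r'.2.1 → r = r') :
    (tablePDA T X).Deterministic := by
  intro t ht t' ht' hs htop hi
  simp only [tablePDA, List.mem_cons, List.mem_map] at ht ht'
  rcases ht with rfl | rfl | ⟨r, hr, rfl⟩ <;> rcases ht' with rfl | rfl | ⟨r', hr', rfl⟩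
  · rfl
  · simp at hs
  · simp at hs
  · simp at hs
  · rfl
  · exact (h₀ _ hr' htop.symm).elim
  · simp at hs
  · exact (h₀ _ hr htop).elim
  · rw [h r hr r' hr' (by simpa using hi) htop]

theorem Reads.steps {X : ℕ} {γ δ : List ℕ} {w : List A} (h : Reads T γ w) :
    Relation.ReflTransGen (tablePDA T X).Step ⟨1, w, γ ++ δ⟩ ⟨1, [], δ⟩ := by
  induction h with
  | nil => exact .refl
  | @cons a Y γ γ' w hT _ ih =>
    refine .head (b := ⟨1, w, γ ++ (γ' ++ δ)⟩)
      ⟨⟨1, some a, Y, 1, γ⟩, ?_, γ' ++ δ, rfl, rfl, rfl, rfl, rfl⟩ ?_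
    · exact List.mem_cons_of_mem _ (List.mem_cons_of_mem _ (List.mem_map_of_mem hT))
    · rwa [← List.append_assoc]

/-- An invariant proved backwards along the run: state 2 has no outgoing move, and in state 1 the
part of the stack above some 0 consumes exactly the unread input. -/
theorem reads_of_steps {X : ℕ} (h₀ : ∀ r ∈ T, 0 ∉ r.2.2) {c : PDA.Config A}
    {δ : List ℕ} (h : Relation.ReflTransGen (tablePDA T X).Step c ⟨2, [], δ⟩) :
    (c.state = 2 → c.unread = []) ∧
    (c.state = 1 → ∃ γ₁ γ₂, c.stack = γ₁ ++ 0 :: γ₂ ∧ Reads T γ₁ c.unread) := by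
  induction h using Relation.ReflTransGen.head_induction_on with
  | refl => simp
  | @head c d hstep _ ih =>
    obtain ⟨t, ht, γ, hs, hu, hst, hs', hst'⟩ := hstep
    simp only [tablePDA, List.mem_cons, List.mem_map] at ht
    rcases ht with rfl | rfl | ⟨r, hr, rfl⟩
    · simp [hs]
    · refine ⟨by simp [hs], fun _ => ⟨[], γ, hst, ?_⟩⟩
      rw [hu, ih.1 hs']
      exact .nil
    · refine ⟨by simp [hs], fun _ => ?_⟩
      obtain ⟨γ₁, γ₂, h₁, h₂⟩ := ih.2 hs'
      rw [hst', List.append_eq_append_iff] at h₁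
      -- No entry pushes a 0, so the 0 that splits the stack lies below the symbols just pushed.
      have key : ∃ γ', γ₁ = r.2.2 ++ γ' ∧ γ = γ' ++ 0 :: γ₂ := by
        rcases h₁ with ⟨a, rfl, h₁⟩ | ⟨a, ha, h₁⟩
        · exact ⟨a, rfl, h₁⟩
        · cases a with
          | nil => exact ⟨[], by simpa using ha.symm, by simpa using h₁.symm⟩
          | cons b a =>
            simp only [List.cons_append, List.cons.injEq] at h₁
            refine (h₀ r hr ?_).elim
            simp only at ha
            rw [ha, h₁.1]
            simp
      obtain ⟨γ', rfl, rfl⟩ := key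
      refine ⟨r.2.1 :: γ', γ₂, hst, ?_⟩
      rw [hu]
      exact .cons (a := r.1) (γ := r.2.2) hr h₂

theorem mem_accepts_tablePDA {X : ℕ} (hX : X ≠ 0) (h₀ : ∀ r ∈ T, 0 ∉ r.2.2) {w : List A} :
    w ∈ (tablePDA T X).accepts ↔ Reads T [X] w := by
  constructor
  · rintro ⟨q, hq, δ, h⟩
    obtain rfl : q = 2 := by simpa [tablePDA] using hq
    rcases h.cases_head with h | ⟨c, hstep, h⟩
    · simp [tablePDA] at h
    obtain ⟨t, ht, γ, hs, hu, hst, hs', hst'⟩ := hstep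
    simp only [tablePDA, List.mem_cons, List.mem_map] at ht
    rcases ht with rfl | rfl | ⟨r, hr, rfl⟩
    · obtain ⟨γ₁, γ₂, h₁, h₂⟩ := (reads_of_steps h₀ h).2 hs'
      have hu : w = c.unread := by simpa using hu
      obtain rfl : γ = [] := by simpa [tablePDA] using hst
      have : γ₁ = [X] := by
        rw [hst'] at h₁
        rcases γ₁ with _ | ⟨a, _ | ⟨b, γ₁⟩⟩
        · simp at h₁; exact (hX h₁.1).elim
        · simp at h₁; simp [h₁.1]
        · simp at h₁
      rwa [hu, ← this]
    · simp [tablePDA] at hs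
    · simp [tablePDA] at hs
  · intro h
    refine ⟨2, by simp [tablePDA], [], ?_⟩
    refine .head (b := ⟨1, w, [X] ++ [0]⟩) ?_ (h.steps.tail ?_)
    · exact ⟨⟨0, none, 0, 1, [X, 0]⟩, by simp [tablePDA], [], rfl, rfl, rfl, rfl, rfl⟩
    · exact ⟨⟨1, none, 0, 2, []⟩, by simp [tablePDA], [], rfl, rfl, rfl, rfl, rfl⟩

end Tables

/-! ### The languages of the queries -/

/-- The entries that do not depend on the number of children that is looked for. -/
def countEntries : List (Bracket × ℕ × List ℕ) :=
  [((0, true), 1, [3, 1]), ((0, true), 2, [3, 2]), ((0, true), 3, [3, 3]), ((0, true), 4, [3, 4]),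
    ((1, true), 2, [4]), ((1, true), 3, [4, 3]), ((1, true), 4, [4, 4]),
    ((0, false), 1, []), ((0, false), 3, []), ((1, false), 4, [])]

/-- From the stack symbol `5` this reads the words `[₀ u ]₀` where `u` is balanced and has
exactly `n` outermost brackets with label `1`. A stack symbol `2` stands for a bracket with label
`1` to be found at the outermost level, `1` for the final closing bracket, `3` and `4` for a closing
bracket with label `0` and `1`. -/
def countTable (n : ℕ) : List (Bracket × ℕ × List ℕ) :=
  ((0, true), 5, List.replicate n 2 ++ [1]) :: countEntries

/-- The words read while one stack symbol is removed. -/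
def Denotes (n : ℕ) : ℕ → List Bracket → Prop
  | 1, w => ∃ F : Forest, F.ones = 0 ∧ w = F.flatten ++ [(0, false)]
  | 2, w => ∃ F G : Forest, F.ones = 0 ∧ w = F.flatten ++ (1, true) :: (G.flatten ++ [(1, false)])
  | 3, w => ∃ F : Forest, w = F.flatten ++ [(0, false)]
  | 4, w => ∃ F : Forest, w = F.flatten ++ [(1, false)]
  | 5, w => ∃ F : Forest, F.ones = n ∧ w = (0, true) :: (F.flatten ++ [(0, false)])
  | _, _ => False

/-- The words read while a stack is emptied. -/
def DenotesStack (n : ℕ) : List ℕ → List Bracket → Prop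
  | [], w => w = []
  | X :: γ, w => ∃ u v, w = u ++ v ∧ Denotes n X u ∧ DenotesStack n γ v

theorem DenotesStack.of_append {n : ℕ} {γ δ : List ℕ} {w : List Bracket}
    (h : DenotesStack n (γ ++ δ) w) :
    ∃ u v, w = u ++ v ∧ DenotesStack n γ u ∧ DenotesStack n δ v := by
  induction γ generalizing w with
  | nil => exact ⟨[], w, rfl, rfl, h⟩
  | cons X γ ih =>
    obtain ⟨u, v, rfl, hu, hv⟩ := h
    obtain ⟨u', v', rfl, hu', hv'⟩ := ih hv
    exact ⟨u ++ u', v', by simp, ⟨u, u', rfl, hu, hu'⟩, hv'⟩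

/-- Each symbol 2 contributes a forest without label-1 roots followed by one label-1 tree; the final
1 contributes a forest with no such root. -/
theorem DenotesStack.of_replicate {m n : ℕ} {w : List Bracket}
    (h : DenotesStack m (List.replicate n 2 ++ [1]) w) :
    ∃ F : Forest, F.ones = n ∧ w = F.flatten ++ [(0, false)] := by
  induction n generalizing w with
  | zero =>
    obtain ⟨u, v, rfl, ⟨F, hF, rfl⟩, rfl⟩ := h
    exact ⟨F, hF, by simp⟩
  | succ n ih =>
    obtain ⟨u, v, rfl, ⟨F, G, hF, rfl⟩, hv⟩ := h
    obtain ⟨H, hH, rfl⟩ := ih hv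
    exact ⟨F.append (.node 1 G H), by simp [Forest.ones_append, Forest.ones, hF, hH, add_comm],
      by simp [Forest.flatten_append, Forest.flatten]⟩

theorem denotes_of_mem {n : ℕ} {r : Bracket × ℕ × List ℕ} (hr : r ∈ countTable n)
    {w : List Bracket} (h : DenotesStack n r.2.2 w) : Denotes n r.2.1 (r.1 :: w) := by
  simp only [countTable, countEntries, List.mem_cons, List.not_mem_nil, or_false] at hr
  rcases hr with rfl | rfl | rfl | rfl | rfl | rfl | rfl | rfl | rfl | rfl | rfl
  · obtain ⟨F, hF, rfl⟩ := h.of_replicate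
    exact ⟨F, hF, rfl⟩
  · obtain ⟨_, _, rfl, ⟨F, rfl⟩, _, _, rfl, ⟨G, hG, rfl⟩, rfl⟩ := h
    exact ⟨.node 0 F G, by simp [Forest.ones, hG], by simp [Forest.flatten]⟩
  · obtain ⟨_, _, rfl, ⟨F, rfl⟩, _, _, rfl, ⟨G, H, hG, rfl⟩, rfl⟩ := h
    exact ⟨.node 0 F G, H, by simp [Forest.ones, hG], by simp [Forest.flatten]⟩
  · obtain ⟨_, _, rfl, ⟨F, rfl⟩, _, _, rfl, ⟨G, rfl⟩, rfl⟩ := h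
    exact ⟨.node 0 F G, by simp [Forest.flatten]⟩
  · obtain ⟨_, _, rfl, ⟨F, rfl⟩, _, _, rfl, ⟨G, rfl⟩, rfl⟩ := h
    exact ⟨.node 0 F G, by simp [Forest.flatten]⟩
  · obtain ⟨_, _, rfl, ⟨F, rfl⟩, rfl⟩ := h
    exact ⟨.nil, F, rfl, by simp [Forest.flatten]⟩
  · obtain ⟨_, _, rfl, ⟨F, rfl⟩, _, _, rfl, ⟨G, rfl⟩, rfl⟩ := h
    exact ⟨.node 1 F G, by simp [Forest.flatten]⟩
  · obtain ⟨_, _, rfl, ⟨F, rfl⟩, _, _, rfl, ⟨G, rfl⟩, rfl⟩ := h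
    exact ⟨.node 1 F G, by simp [Forest.flatten]⟩
  · obtain rfl := h
    exact ⟨.nil, rfl, rfl⟩
  · obtain rfl := h
    exact ⟨.nil, rfl⟩
  · obtain rfl := h
    exact ⟨.nil, rfl⟩

/-- Soundness of the table. The converse is needed only for the nested words, where it is checked
directly. -/
theorem Reads.denotesStack {n : ℕ} {γ : List ℕ} {w : List Bracket}
    (h : Reads (countTable n) γ w) : DenotesStack n γ w := by
  induction h with
  | nil => rfl
  | @cons a X γ δ w hT _ ih =>
    obtain ⟨u, v, rfl, hu, hv⟩ := ih.of_append
    exact ⟨a :: u, v, rfl, denotes_of_mem hT hu, hv⟩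

theorem Reads.exists_forest {n : ℕ} {w : List Bracket} (h : Reads (countTable n) [5] w) :
    ∃ F : Forest, F.ones = n ∧ w = (0, true) :: (F.flatten ++ [(0, false)]) := by
  obtain ⟨u, v, rfl, ⟨F, hF, rfl⟩, rfl⟩ := h.denotesStack
  exact ⟨F, hF, by simp⟩

variable {f : ℕ → ℕ} {n : ℕ} {δ : List ℕ} {w v : List Bracket}

theorem reads_children {t : ℕ} (hv : ∀ X ∈ [2, 3, 4], ∀ δ w, Reads (countTable n) (X :: δ) w →
      Reads (countTable n) (X :: δ) (word f t ++ w))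
    (k : ℕ) (h : Reads (countTable n) (3 :: δ) w) :
    Reads (countTable n) (3 :: δ) (children (word f t) k ++ w) := by
  induction k with
  | zero => exact hv _ (by simp) _ _ h
  | succ k ih =>
    simp only [children, List.append_assoc, List.cons_append]
    refine hv _ (by simp) _ _ (.cons (γ := [4, 3]) (by simp [countTable, countEntries]) ?_)
    exact hv _ (by simp) _ _ (.cons (γ := []) (by simp [countTable, countEntries]) ih)

/-- Outermost brackets have label 0, and each of these symbols passes over them by stacking a 3
above itself. Above that 3, label-1 brackets are matched without being counted. -/
theorem reads_word (t : ℕ) : ∀ X ∈ [1, 2, 3, 4], ∀ δ w, Reads (countTable n) (X :: δ) w →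
    Reads (countTable n) (X :: δ) (word f t ++ w) := by
  induction t with
  | zero => intro _ _ _ _ h; exact h
  | succ t ih =>
    intro X hX δ w h
    simp only [word, List.append_assoc, List.cons_append]
    refine ih X hX _ _ (.cons (γ := [3, X]) ?_ ?_)
    · revert X; simp [countTable, countEntries]
    · refine reads_children (fun Y hY => ih Y (List.mem_cons_of_mem _ hY)) _ ?_
      exact .cons (γ := []) (by simp [countTable, countEntries]) (ih X hX _ _ h)

theorem reads_count_children (t k : ℕ) :
    Reads (countTable n) (List.replicate k 2 ++ [1]) (children (word f t) k ++ [(0, false)]) := by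
  induction k with
  | zero =>
    exact reads_word t _ (by simp) _ _ (.cons (γ := []) (by simp [countTable, countEntries]) .nil)
  | succ k ih =>
    simp only [children, List.append_assoc, List.cons_append, List.replicate_succ]
    refine reads_word t _ (by simp) _ _ (.cons (γ := [4]) (by simp [countTable, countEntries]) ?_)
    exact reads_word t _ (by simp) _ _ (.cons (γ := []) (by simp [countTable, countEntries]) ih)

theorem exists_reads_countTable_iff :
    (∃ w, w ∈ language (factorShift (word f)) ∧ Reads (countTable n) [5] w) ↔ ∃ t, f t = n := by
  simp only [mem_language_factorShift_word]
  constructor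
  · rintro ⟨w, ⟨t, ht⟩, h⟩
    obtain ⟨F, rfl, rfl⟩ := h.exists_forest
    exact exists_eq_ones_of_infix_word ht
  · rintro ⟨t, rfl⟩
    -- The witness is the new 0-bracket of w_{t+1} with its content.
    refine ⟨(0, true) :: (children (word f t) (f t) ++ [(0, false)]),
      ⟨t + 1, word f t, word f t, by simp [word]⟩, ?_⟩
    exact .cons (γ := List.replicate (f t) 2 ++ [1]) (by simp [countTable])
      (by simpa using reads_count_children t (f t))

/-- The deterministic pushdown automaton of `countTable n`. -/
def countDPDA (n : ℕ) : DPDA Bracket := ⟨tablePDA (countTable n) 5, by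
  -- Only the entry with top symbol 5 depends on n; everything else is a finite check.
  have h5 : ∀ r ∈ countEntries, r.2.1 ≠ 0 ∧ r.2.1 ≠ 5 := by decide
  have hE : ∀ r ∈ countEntries, ∀ r' ∈ countEntries, r.1 = r'.1 → r.2.1 = r'.2.1 → r = r' := by
    decide
  apply deterministic_tablePDA
  · intro r hr
    rcases List.mem_cons.1 hr with rfl | hr
    · simp
    · exact (h5 r hr).1
  · intro r hr r' hr' h1 h2
    rcases List.mem_cons.1 hr with rfl | hr <;> rcases List.mem_cons.1 hr' with rfl | hr'
    · rfl
    · exact ((h5 r' hr').2 h2.symm).elim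
    · exact ((h5 r hr).2 h2).elim
    · exact hE r hr r' hr' h1 h2⟩

theorem mem_accepts_countDPDA : w ∈ (countDPDA n).accepts ↔ Reads (countTable n) [5] w := by
  refine mem_accepts_tablePDA (by decide) fun r hr => ?_
  have hE : ∀ r ∈ countEntries, 0 ∉ r.2.2 := by decide
  rcases List.mem_cons.1 hr with rfl | hr
  · simp
  · exact hE r hr

/-! ### Recursively enumerable predicates -/

/-- Unbounded search through the codes of possible witnesses b. -/
theorem rePred_exists {α β : Type} [Primcodable α] [Primcodable β] {p : α → β → Prop} (hp : PrimrecRel p) : REPred fun a => ∃ b, p a b := by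
  classical
  have hf : Primrec₂ fun (a : α) (n : ℕ) => (Encodable.decode (α := β) n).bind fun b =>
      if p a b then some () else none := by
    refine Primrec.option_bind (Primrec.decode.comp Primrec.snd) ?_
    refine Primrec.ite ?_ (Primrec.const _) (Primrec.const _)
    exact PrimrecPred.comp (p := fun q : α × β => p q.1 q.2) hp
      ((Primrec.fst.comp Primrec.fst).pair Primrec.snd)
  refine (Partrec.rfindOpt hf.to_comp).dom_re.of_eq fun a => ?_
  rw [Nat.rfindOpt_dom]
  constructor
  · rintro ⟨n, u, hu⟩
    obtain ⟨b, -, hb⟩ := Option.bind_eq_some_iff.1 hu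
    by_cases h : p a b
    · exact ⟨b, h⟩
    · simp [h] at hb
  · rintro ⟨b, hb⟩
    exact ⟨Encodable.encode b, (), by simp [hb]⟩

section Computability

variable {α σ ε : Type}

open Classical in
/-- Follow a list of proposed steps, ignoring those that are not justified by `R`. -/
noncomputable def follow (R : α → σ → σ → ε → Prop) (a : α) (c : σ) (l : List (σ × ε)) : σ :=
  l.foldl (fun c p => if R a c p.1 p.2 then p.1 else c) c

/-- Reachability becomes the existence of a list checked primitive recursively. As unjustified steps
are ignored, every list describes a genuine run. -/
theorem reflTransGen_iff_follow {R : α → σ → σ → ε → Prop} {a : α} {c d : σ} :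
    Relation.ReflTransGen (fun c d => ∃ e, R a c d e) c d ↔ ∃ l, follow R a c l = d := by
  constructor
  · intro h
    induction h with
    | refl => exact ⟨[], rfl⟩
    | @tail b d _ h ih =>
      obtain ⟨l, hl⟩ := ih
      obtain ⟨e, he⟩ := h
      refine ⟨l ++ [(d, e)], ?_⟩
      rw [follow] at hl
      simp [follow, hl, he]
  · rintro ⟨l, rfl⟩
    induction l generalizing c with
    | nil => exact .refl
    | cons p l ih =>
      simp only [follow, List.foldl_cons] at ih ⊢
      split_ifs with h
      · exact .head ⟨_, h⟩ ih
      · exact ih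

variable [Primcodable α] [Primcodable σ] [Primcodable ε]

theorem primrec_follow {R : α → σ → σ → ε → Prop}
    (hR : PrimrecPred fun x : α × σ × σ × ε => R x.1 x.2.1 x.2.2.1 x.2.2.2) :
    Primrec fun x : α × σ × List (σ × ε) => follow R x.1 x.2.1 x.2.2 := by
  classical
  have hstep : Primrec₂ fun (x : α × σ × List (σ × ε)) (y : σ × σ × ε) =>
      if R x.1 y.1 y.2.1 y.2.2 then y.2.1 else y.1 := by
    refine Primrec.ite ?_ (Primrec.fst.comp (Primrec.snd.comp Primrec.snd))
      (Primrec.fst.comp Primrec.snd)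
    exact hR.comp ((Primrec.fst.comp Primrec.fst).pair Primrec.snd)
  exact (Primrec.list_foldl (Primrec.snd.comp Primrec.snd) (Primrec.fst.comp Primrec.snd) hstep)

theorem primrecRel_mem : PrimrecRel fun (a : α) (l : List α) => a ∈ l :=
  (PrimrecRel.comp (PrimrecRel.exists_mem_list (R := fun a b : α => a = b) Primrec.eq)
    Primrec.snd Primrec.fst).of_eq fun x => by simp

theorem primrecRel_infix : PrimrecRel fun u v : List α => u <:+: v := by
  have h1 : PrimrecRel fun (i : ℕ) (x : List α × List α) => (x.2.drop i).take x.1.length = x.1 :=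
    Primrec.eq.comp (Primrec.list_take.comp
      (Primrec.list_length.comp (Primrec.fst.comp Primrec.snd))
      (Primrec.list_drop.comp Primrec.fst (Primrec.snd.comp Primrec.snd)))
      (Primrec.fst.comp Primrec.snd)
  have h3 : Primrec fun x : List α × List α => x.2.length + 1 :=
    Primrec.succ.comp (Primrec.list_length.comp Primrec.snd)
  refine (h1.exists_mem_list.comp (Primrec.list_range.comp h3) Primrec.id).of_eq fun x => ?_
  obtain ⟨u, v⟩ := x
  constructor
  · rintro ⟨i, -, h⟩
    simp only [id] at h
    rw [← h]
    exact (List.take_prefix _ _).isInfix.trans (List.drop_suffix _ _).isInfix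
  · rintro ⟨p, q, h⟩
    dsimp only at h
    subst h
    exact ⟨p.length, List.mem_range.2 (by simp), by simp⟩

end Computability

/-! ### The languages are recursively enumerable -/

section Enumerability

variable {A : Type}

theorem primrec_initial [Primcodable A] : Primrec (GrammarCode.initial : GrammarCode A → ℕ) :=
  Primrec.fst.comp (Primrec.of_equiv (e := GrammarCode.equivProd A))

theorem primrec_rules [Primcodable A] : Primrec (GrammarCode.rules : GrammarCode A → _) :=
  Primrec.snd.comp (Primrec.of_equiv (e := GrammarCode.equivProd A))

/-- A derivation step of a coded grammar, with the rule and the position as witness. -/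
def CodeProduces (g : GrammarCode A) (c d : List (A ⊕ ℕ))
    (e : (ℕ × List (A ⊕ ℕ)) × List (A ⊕ ℕ) × List (A ⊕ ℕ)) : Prop :=
  e.1 ∈ g.rules ∧ c = e.2.1 ++ ([.inr e.1.1] ++ e.2.2) ∧ d = e.2.1 ++ (e.1.2 ++ e.2.2)

theorem primrecPred_codeProduces [Primcodable A] : PrimrecPred fun x : GrammarCode A × List (A ⊕ ℕ) ×
    List (A ⊕ ℕ) × (ℕ × List (A ⊕ ℕ)) × List (A ⊕ ℕ) × List (A ⊕ ℕ) =>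
      CodeProduces x.1 x.2.1 x.2.2.1 x.2.2.2 := by
  have he : Primrec fun x : GrammarCode A × List (A ⊕ ℕ) ×
    List (A ⊕ ℕ) × (ℕ × List (A ⊕ ℕ)) × List (A ⊕ ℕ) × List (A ⊕ ℕ) => x.2.2.2 :=
    Primrec.snd.comp (Primrec.snd.comp Primrec.snd)
  have hr := Primrec.fst.comp he
  have hp := Primrec.fst.comp (Primrec.snd.comp he)
  have hq := Primrec.snd.comp (Primrec.snd.comp he)
  refine (primrecRel_mem.comp hr (primrec_rules.comp Primrec.fst)).and
    ((Primrec.eq.comp (Primrec.fst.comp Primrec.snd) ?_).and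
      (Primrec.eq.comp (Primrec.fst.comp (Primrec.snd.comp Primrec.snd)) ?_))
  · exact Primrec.list_append.comp hp (Primrec.list_append.comp
      (Primrec.list_cons.comp (Primrec.sumInr.comp (Primrec.fst.comp hr)) (Primrec.const [])) hq)
  · exact Primrec.list_append.comp hp (Primrec.list_append.comp (Primrec.snd.comp hr) hq)

/-- The symbols of coded grammars as symbols of grammars. -/
def symbolEquiv (A : Type) : A ⊕ ℕ ≃ Symbol A ℕ where
  toFun := Sum.elim Symbol.terminal Symbol.nonterminal
  invFun
    | .terminal a => .inl a
    | .nonterminal n => .inr n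
  left_inv := by rintro (_ | _) <;> rfl
  right_inv := by rintro (_ | _) <;> rfl

theorem produces_toGrammar_iff [DecidableEq A] {g : GrammarCode A} {c d : List (A ⊕ ℕ)} :
    (∃ r : ContextFreeRule A ℕ, r ∈ g.toGrammar.rules ∧
      r.Rewrites (c.map (symbolEquiv A)) (d.map (symbolEquiv A))) ↔ ∃ e, CodeProduces g c d e := by
  have hinj : Function.Injective (List.map (symbolEquiv A)) :=
    List.map_injective_iff.2 (symbolEquiv A).injective
  constructor
  · rintro ⟨r, hr, hrw⟩
    obtain ⟨p, q, h1, h2⟩ := hrw.exists_parts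
    obtain ⟨e, he, rfl⟩ := mem_rules_toGrammar.1 hr
    obtain ⟨p, rfl⟩ := List.map_surjective_iff.2 (symbolEquiv A).surjective p
    obtain ⟨q, rfl⟩ := List.map_surjective_iff.2 (symbolEquiv A).surjective q
    refine ⟨(e, p, q), he, hinj ?_, hinj ?_⟩
    · rw [h1]; simp [symbolEquiv, GrammarCode.toRule]
    · rw [h2]; simp [symbolEquiv, GrammarCode.toRule]
  · rintro ⟨⟨e, p, q⟩, he, rfl, rfl⟩
    refine ⟨GrammarCode.toRule e, mem_rules_toGrammar.2 ⟨e, he, rfl⟩, ?_⟩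
    · have := (GrammarCode.toRule e).rewrites_of_exists_parts (p.map (symbolEquiv A))
        (q.map (symbolEquiv A))
      simpa [symbolEquiv, GrammarCode.toRule] using this

theorem mem_language_toGrammar_iff [DecidableEq A] {g : GrammarCode A} {w : List A} :
    w ∈ g.toGrammar.language ↔ ∃ l, follow CodeProduces g [.inr g.initial] l = w.map .inl := by
  rw [← reflTransGen_iff_follow]
  constructor
  · intro h
    have := Relation.ReflTransGen.lift (p := fun c d => ∃ e, CodeProduces g c d e)
      (List.map (symbolEquiv A).symm) (fun a b hab => ?_) _ _ h
    · simpa [symbolEquiv, GrammarCode.toGrammar, Function.comp_def, Function.onFun] using this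
    · refine produces_toGrammar_iff.1 ?_
      obtain ⟨r, hr, hrw⟩ := hab
      refine ⟨r, hr, ?_⟩
      rw [List.map_map, List.map_map, Equiv.self_comp_symm, List.map_id, List.map_id]
      exact hrw
  · intro h
    have := Relation.ReflTransGen.lift (p := g.toGrammar.Produces)
      (List.map (symbolEquiv A)) (fun a b hab => produces_toGrammar_iff.2 hab) _ _ h
    have key : ∀ v : List (Symbol A ℕ), (w.map Sum.inl).map (symbolEquiv A) = v →
        g.toGrammar.Derives [.nonterminal g.initial] v := by
      rintro _ rfl
      exact this
    exact key _ (List.map_map ..)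

/-- A move of a pushdown automaton, with the transition and the rest of the stack as witness. -/
def CodeStep (M : PDA A) (c d : ℕ × List A × List ℕ) (e : Transition A × List ℕ) : Prop :=
  e.1 ∈ M.transitions ∧ c.1 = e.1.source ∧ c.2.1 = e.1.input.toList ++ d.2.1 ∧
    c.2.2 = e.1.top :: e.2 ∧ d.1 = e.1.target ∧ d.2.2 = e.1.push ++ e.2

theorem primrecPred_codeStep [Primcodable A] : PrimrecPred fun x : PDA A × (ℕ × List A × List ℕ) ×
    (ℕ × List A × List ℕ) × Transition A × List ℕ => CodeStep x.1 x.2.1 x.2.2.1 x.2.2.2 := by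
  have hc : Primrec fun x : PDA A × (ℕ × List A × List ℕ) ×
    (ℕ × List A × List ℕ) × Transition A × List ℕ => x.2.1 := Primrec.fst.comp Primrec.snd
  have hd : Primrec fun x : PDA A × (ℕ × List A × List ℕ) ×
    (ℕ × List A × List ℕ) × Transition A × List ℕ => x.2.2.1 :=
    Primrec.fst.comp (Primrec.snd.comp Primrec.snd)
  have ht : Primrec fun x : PDA A × (ℕ × List A × List ℕ) ×
    (ℕ × List A × List ℕ) × Transition A × List ℕ => x.2.2.2.1 :=
    Primrec.fst.comp (Primrec.snd.comp (Primrec.snd.comp Primrec.snd))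
  have hγ : Primrec fun x : PDA A × (ℕ × List A × List ℕ) ×
    (ℕ × List A × List ℕ) × Transition A × List ℕ => x.2.2.2.2 :=
    Primrec.snd.comp (Primrec.snd.comp (Primrec.snd.comp Primrec.snd))
  have e0 : Primrec (PDA.transitionEquiv A) := Primrec.of_equiv (e := PDA.transitionEquiv A)
  have e1 := Primrec.snd.comp e0
  have e2 := Primrec.snd.comp e1
  have e3 := Primrec.snd.comp e2
  have hin : Primrec fun o : Option A => o.toList :=
    (Primrec.option_casesOn (f := fun _ => []) (g := fun _ a => [a]) Primrec.id (Primrec.const [])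
      (Primrec.list_cons.comp Primrec.snd (Primrec.const []))).of_eq fun o => by cases o <;> rfl
  exact (primrecRel_mem.comp ht (PDA.primrec_transitions.comp Primrec.fst)).and <|
    (Primrec.eq.comp (Primrec.fst.comp hc) ((Primrec.fst.comp e0).comp ht)).and <|
    (Primrec.eq.comp (Primrec.fst.comp (Primrec.snd.comp hc))
      (Primrec.list_append.comp (hin.comp ((Primrec.fst.comp e1).comp ht))
        (Primrec.fst.comp (Primrec.snd.comp hd)))).and <|
    (Primrec.eq.comp (Primrec.snd.comp (Primrec.snd.comp hc))
      (Primrec.list_cons.comp ((Primrec.fst.comp e2).comp ht) hγ)).and <|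
    (Primrec.eq.comp (Primrec.fst.comp hd) ((Primrec.fst.comp e3).comp ht)).and <|
    Primrec.eq.comp (Primrec.snd.comp (Primrec.snd.comp hd))
      (Primrec.list_append.comp ((Primrec.snd.comp e3).comp ht) hγ)

theorem mem_accepts_iff {M : PDA A} {w : List A} :
    w ∈ M.accepts ↔ ∃ x : ℕ × List ℕ × List ((ℕ × List A × List ℕ) × Transition A × List ℕ),
      x.1 ∈ M.accepting ∧ follow CodeStep M (M.start, w, [M.bottom]) x.2.2 = (x.1, [], x.2.1) := by
  constructor
  · rintro ⟨q, hq, γ, h⟩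
    have := Relation.ReflTransGen.lift (p := fun c d => ∃ e, CodeStep M c d e)
      (fun c : PDA.Config A => (c.state, c.unread, c.stack)) (fun a b hab => ?_) _ _ h
    · obtain ⟨l, hl⟩ := reflTransGen_iff_follow.1 this
      exact ⟨(q, γ, l), hq, hl⟩
    · obtain ⟨t, ht, γ, h⟩ := hab
      exact ⟨(t, γ), ht, h⟩
  · rintro ⟨⟨q, γ, l⟩, hq, hl⟩
    have := Relation.ReflTransGen.lift (p := M.Step)
      (fun c : ℕ × List A × List ℕ => (⟨c.1, c.2.1, c.2.2⟩ : PDA.Config A)) (fun a b hab => ?_)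
      _ _ (reflTransGen_iff_follow.2 ⟨l, hl⟩)
    · exact ⟨q, hq, γ, this⟩
    · obtain ⟨⟨t, γ⟩, ht, h⟩ := hab
      exact ⟨t, ht, γ, h⟩

variable {p : List A → Prop}

theorem rePred_exists_mem_language [Primcodable A] [DecidableEq A] (hp : PrimrecPred p) :
    REPred fun g : GrammarCode A => ∃ w, p w ∧ w ∈ g.toGrammar.language := by
  have h : PrimrecRel fun (g : GrammarCode A) (x : List A × List (List (A ⊕ ℕ) ×
      (ℕ × List (A ⊕ ℕ)) × List (A ⊕ ℕ) × List (A ⊕ ℕ))) =>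
      p x.1 ∧ follow CodeProduces g [.inr g.initial] x.2 = x.1.map .inl := by
    refine PrimrecPred.and (hp.comp (Primrec.fst.comp Primrec.snd)) (Primrec.eq.comp ?_ ?_)
    · exact (primrec_follow primrecPred_codeProduces).comp <| Primrec.fst.pair <|
        (Primrec.list_cons.comp (Primrec.sumInr.comp (primrec_initial.comp Primrec.fst))
          (Primrec.const [])).pair (Primrec.snd.comp Primrec.snd)
    · exact Primrec.list_map (Primrec.fst.comp Primrec.snd) (Primrec.sumInl.comp Primrec.snd)
  refine (rePred_exists h).of_eq fun g => ?_
  simp only [mem_language_toGrammar_iff, Prod.exists, exists_and_left]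

theorem rePred_exists_mem_accepts [Primcodable A] (hp : PrimrecPred p) :
    REPred fun M : DPDA A => ∃ w, p w ∧ w ∈ M.accepts := by
  classical
  have hv : Primrec fun M : DPDA A => M.1 :=
    Primrec.subtype_val (hp := PDA.primrecPred_deterministic)
  have hM : Primrec fun M : DPDA A => PDA.equivProd A M.1 :=
    (Primrec.of_equiv (e := PDA.equivProd A)).comp hv
  have h : PrimrecRel fun (M : DPDA A) (x : List A × ℕ × List ℕ ×
      List ((ℕ × List A × List ℕ) × Transition A × List ℕ)) =>
      p x.1 ∧ x.2.1 ∈ M.1.accepting ∧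
        follow CodeStep M.1 (M.1.start, x.1, [M.1.bottom]) x.2.2.2 = (x.2.1, [], x.2.2.1) := by
    refine PrimrecPred.and (hp.comp (Primrec.fst.comp Primrec.snd)) (PrimrecPred.and ?_ ?_)
    · exact primrecRel_mem.comp (Primrec.fst.comp (Primrec.snd.comp Primrec.snd))
        ((Primrec.fst.comp (Primrec.snd.comp (Primrec.snd.comp hM))).comp Primrec.fst)
    refine Primrec.eq.comp ?_ ?_
    · refine (primrec_follow primrecPred_codeStep).comp <| Primrec.pair ?_ <| Primrec.pair
        (Primrec.pair ?_ (Primrec.pair (Primrec.fst.comp Primrec.snd) ?_)) ?_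
      · exact hv.comp Primrec.fst
      · exact (Primrec.fst.comp hM).comp Primrec.fst
      · exact Primrec.list_cons.comp ((Primrec.fst.comp (Primrec.snd.comp hM)).comp Primrec.fst)
          (Primrec.const [])
      · exact Primrec.snd.comp (Primrec.snd.comp (Primrec.snd.comp Primrec.snd))
    · exact (Primrec.fst.comp (Primrec.snd.comp Primrec.snd)).pair <| (Primrec.const []).pair
        (Primrec.fst.comp (Primrec.snd.comp (Primrec.snd.comp Primrec.snd)))
  refine (rePred_exists h).of_eq fun M => ?_
  simp only [DPDA.accepts, mem_accepts_iff]
  constructor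
  · rintro ⟨⟨w, x⟩, h1, h2⟩
    exact ⟨w, h1, x, h2⟩
  · rintro ⟨w, h1, x, h2⟩
    exact ⟨⟨w, x⟩, h1, h2⟩

end Enumerability

/-! ### Computability of the construction -/

theorem primrec_children : Primrec₂ children := by
  refine (Primrec.nat_rec' (f := fun x : List Bracket × ℕ => x.2)
    (g := fun x : List Bracket × ℕ => x.1)
    (h := fun x y => x.1 ++ (1, true) :: (x.1 ++ (1, false) :: y.2)) Primrec.snd
    Primrec.fst ?_).of_eq fun x => ?_
  · have hx : Primrec fun z : (List Bracket × ℕ) × ℕ × List Bracket => z.1.1 :=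
      Primrec.fst.comp Primrec.fst
    exact Primrec.list_append.comp hx (Primrec.list_cons.comp (Primrec.const _)
      (Primrec.list_append.comp hx (Primrec.list_cons.comp (Primrec.const _)
        (Primrec.snd.comp Primrec.snd))))
  · obtain ⟨w, k⟩ := x
    induction k with
    | zero => rfl
    | succ k ih => simp only [children] at ih ⊢; rw [← ih]

theorem primrec_word {f : ℕ → ℕ} (hf : Primrec f) : Primrec (word f) := by
  refine (Primrec.nat_rec₁ (f := fun t w =>
    w ++ (0, true) :: (children w (f t) ++ (0, false) :: w)) ([] : List Bracket) ?_).of_eq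
    fun t => ?_
  · exact Primrec.list_append.comp Primrec.snd (Primrec.list_cons.comp (Primrec.const _)
      (Primrec.list_append.comp (primrec_children.comp Primrec.snd (hf.comp Primrec.fst))
        (Primrec.list_cons.comp (Primrec.const _) Primrec.snd)))
  · induction t with
    | zero => rfl
    | succ t ih => simp only [word]; rw [← ih]

/-- By `infix_word_iff` a single word of computable level decides membership. -/
theorem primrecPred_mem_language {f : ℕ → ℕ} (hf : Primrec f) (h : ∀ t, 1 ≤ f t) :
    PrimrecPred fun w => w ∈ language (factorShift (word f)) :=
  (primrecRel_infix.comp Primrec.id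
    ((primrec_word hf).comp (Primrec.succ.comp Primrec.list_length))).of_eq fun w => by
      rw [mem_language_factorShift_word, infix_word_iff h]; rfl

theorem primrec_replicate : Primrec fun n : ℕ => List.replicate n 2 :=
  (Primrec.nat_rec₁ (f := fun _ (l : List ℕ) => 2 :: l) [] (Primrec.list_cons.comp
    (Primrec.const 2) Primrec.snd)).of_eq fun n => by
      induction n with
      | zero => rfl
      | succ n ih => rw [List.replicate_succ, ← ih]

theorem primrec_countTable : Primrec countTable :=
  Primrec.list_cons.comp ((Primrec.const _).pair <| (Primrec.const _).pair <|
    Primrec.list_append.comp primrec_replicate (Primrec.const _)) (Primrec.const _)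

theorem primrec_countGrammar : Primrec fun n => tableGrammar (countTable n) 5 := by
  suffices h : Primrec fun n => (countTable n).map fun r =>
      (r.2.1, (Sum.inl r.1 :: r.2.2.map Sum.inr : List (Bracket ⊕ ℕ))) from
    (Primrec.of_equiv_symm (e := GrammarCode.equivProd Bracket)).comp
      ((Primrec.const 5).pair h)
  refine Primrec.list_map primrec_countTable ?_
  have hr : Primrec fun x : ℕ × (Bracket × ℕ × List ℕ) => x.2 := Primrec.snd
  exact (Primrec.fst.comp (Primrec.snd.comp hr)).pair (Primrec.list_cons.comp
    (Primrec.sumInl.comp (Primrec.fst.comp hr)) (Primrec.list_map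
      (Primrec.snd.comp (Primrec.snd.comp hr)) (Primrec.sumInr.comp Primrec.snd)))

theorem primrec_countDPDA : Primrec countDPDA := by
  classical
  refine Primrec.subtype_mk (hp := PDA.primrecPred_deterministic)
    (f := fun n => tablePDA (countTable n) 5) ?_
  refine (Primrec.of_equiv_symm (e := PDA.equivProd Bracket)).comp
    ((Primrec.const 0).pair <| (Primrec.const 0).pair <| (Primrec.const [2]).pair ?_)
  refine Primrec.list_cons.comp (Primrec.const _) (Primrec.list_cons.comp (Primrec.const _) ?_)
  refine Primrec.list_map primrec_countTable ?_
  have hr : Primrec fun x : ℕ × (Bracket × ℕ × List ℕ) => x.2 := Primrec.snd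
  exact (Primrec.of_equiv_symm (e := PDA.transitionEquiv Bracket)).comp <|
    (Primrec.const 1).pair <| (Primrec.option_some.comp (Primrec.fst.comp hr)).pair <|
    (Primrec.fst.comp (Primrec.snd.comp hr)).pair <| (Primrec.const 1).pair <|
    Primrec.snd.comp (Primrec.snd.comp hr)

/-! ### Completeness -/

open Nat.Partrec (Code)
open Nat.Partrec.Code (eval evaln)

/-- `m + 2` if the computation of the `m.unpair.1`-th program on the input `m.unpair.2` halts within
`k` steps, where `t` codes the pair of `k` and `m`, and `1` otherwise. -/
def haltingSequence (t : ℕ) : ℕ :=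
  if (evaln t.unpair.1 (Denumerable.ofNat Code t.unpair.2.unpair.1) t.unpair.2.unpair.2).isSome
  then t.unpair.2 + 2 else 1

/-- Every level needs at least one child, so 1 is the dummy value, and the shift by 2 keeps the
halting codes apart from it. -/
theorem one_le_haltingSequence (t : ℕ) : 1 ≤ haltingSequence t := by
  unfold haltingSequence
  split_ifs <;> omega

theorem primrec_haltingSequence : Primrec haltingSequence := by
  have h1 : Primrec fun t : ℕ => t.unpair.1 := Primrec.fst.comp Primrec.unpair
  have h2 : Primrec fun t : ℕ => t.unpair.2 := Primrec.snd.comp Primrec.unpair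
  refine Primrec.ite (Primrec.eq.comp (Primrec.option_isSome.comp ?_) (Primrec.const true))
    (Primrec.nat_add.comp h2 (Primrec.const 2)) (Primrec.const 1)
  exact Nat.Partrec.Code.primrec_evaln.comp
    ((h1.pair ((Primrec.ofNat Code).comp (h1.comp h2))).pair (h2.comp h2))

theorem exists_haltingSequence_eq (m : ℕ) : (∃ t, haltingSequence t = m + 2) ↔
    (eval (Denumerable.ofNat Code m.unpair.1) m.unpair.2).Dom := by
  rw [Part.dom_iff_mem]
  simp only [Nat.Partrec.Code.evaln_complete]
  constructor
  · rintro ⟨t, ht⟩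
    unfold haltingSequence at ht
    split_ifs at ht with h
    · obtain rfl : t.unpair.2 = m := by omega
      obtain ⟨y, hy⟩ := Option.isSome_iff_exists.1 h
      exact ⟨y, _, hy⟩
    · omega
  · rintro ⟨y, k, hy⟩
    refine ⟨Nat.pair k m, ?_⟩
    have h : evaln k (Denumerable.ofNat Code m.unpair.1) m.unpair.2 = some y := hy
    simp [haltingSequence, h]

theorem exists_code_of_rePred {q : ℕ → Prop} (hq : REPred q) :
    ∃ c : Code, ∀ n, q n ↔ (eval c n).Dom := by
  obtain ⟨c, hc⟩ := Nat.Partrec.Code.exists_code.1 hq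
  refine ⟨c, fun n => ?_⟩
  rw [hc]
  simp [Part.assert]

/-- If q is the domain of the program c, then q n holds iff the pair (c, n), shifted by 2, is a
value of `haltingSequence`; F turns that value into a query. -/
theorem sigmaZeroOneComplete_of {α : Type} [Primcodable α] {p : α → Prop} (hp : REPred p)
    {F : ℕ → α} (hF : Primrec F) (h : ∀ n, p (F n) ↔ ∃ t, haltingSequence t = n) :
    SigmaZeroOneComplete p := by
  refine ⟨hp, fun q hq => ?_⟩
  obtain ⟨c, hc⟩ := exists_code_of_rePred hq
  refine ⟨fun n => F (Nat.pair (Encodable.encode c) n + 2), ?_, fun n => ?_⟩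
  · exact (hF.comp (Primrec.nat_add.comp
      (Primrec₂.natPair.comp (Primrec.const _) Primrec.id) (Primrec.const 2))).to_comp
  · rw [h, exists_haltingSequence_eq, hc]
    simp

end ModelChecking

theorem mainTheorem9 :
    ∃ X : SymbolicDynamics.FullShift.Subshift ModelChecking.Bracket ℤ,
      ModelChecking.IsMinimal X ∧
      ModelChecking.IsPiZeroOne X ∧
      X.carrier ⊆ ModelChecking.dyckShift ∧
      ModelChecking.SigmaZeroOneComplete (ModelChecking.contextFreeModelChecking X) ∧
      ModelChecking.SigmaZeroOneComplete (ModelChecking.dpdaModelChecking X) := by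
  -- Decidability of the language serves three times: for the Π⁰₁ property and for the enumerability
  -- of both problems.
  have hp := ModelChecking.primrecPred_mem_language ModelChecking.primrec_haltingSequence
    ModelChecking.one_le_haltingSequence
  refine ⟨ModelChecking.factorShift (ModelChecking.word ModelChecking.haltingSequence),
    ModelChecking.isMinimal_factorShift_word, hp.not.computablePred.to_re,
    ModelChecking.factorShift_word_subset_dyckShift _, ?_, ?_⟩
  · refine ModelChecking.sigmaZeroOneComplete_of (ModelChecking.rePred_exists_mem_language hp)
      ModelChecking.primrec_countGrammar fun n => ?_
    rw [← ModelChecking.exists_reads_countTable_iff]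
    simp only [ModelChecking.contextFreeModelChecking, ModelChecking.mem_language_tableGrammar]
  · refine ModelChecking.sigmaZeroOneComplete_of (ModelChecking.rePred_exists_mem_accepts hp)
      ModelChecking.primrec_countDPDA fun n => ?_
    rw [← ModelChecking.exists_reads_countTable_iff]
    simp only [ModelChecking.dpdaModelChecking, ModelChecking.mem_accepts_countDPDA]
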